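/- Let $G=(V,E)$ be a finite undirected graph, and let $S=\{s_1,\dots,s_k\}$ and $T=\{t_1,\dots,t_k\}$ be disjoint sets of $k$ vertices each, with the indicated orderings. A disjoint $S$--$T$ path is a set $P\subseteq E$ that is the union of the edge sets of $k$ pairwise vertex-disjoint paths $P_1,\dots,P_k$ of $G$, where $P_i$ joins $s_i$ to $t_{\sigma(i)}$ for some permutation $\sigma$ of $\{1,\dots,k\}$. This permutation $\sigma=\sigma_P$ is determined by $P$, and $\operatorname{sgn}P:=\operatorname{sgn}\sigma_P$. The pair $(S,T)$ is in the LGV position if all disjoint $S$--$T$ paths have the same sign. Let $\tilde V=V\setminus(S\cup T)$ and let $G^*$ be the graph obtained from $G$ by adding a new vertex $v^*$ and the edges $E'=\{\{v,v^*\}: v\in\tilde V\}$; put $E^*=E\cup E'$. Let $A\in\mathbb{Q}^{(V\cup\{v^*\})\times E^*}$ be the incidence matrix of an arbitrary orientation of $G^*$ ($+1$ at the tail, $-1$ at the head of each edge, columns of loops being zero). Let $A_1=A[S\cup\tilde V,E^*]$ and $A_2=A[T\cup\tilde V,E^*]$, where the $i$th rows of $A_1$ and $A_2$ are those of $s_i$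 and $t_i$ for $i\le k$, and the remaining rows, indexed by $\tilde V$, are in the same order in both matrices. A common base of $(A_1,A_2)$ is a set $B\subseteq E^*$ with $|B|=k+|\tilde V|$ such that the column submatrices $A_1[B]$ and $A_2[B]$ are both nonsingular; their columns are always listed in the same order. The pair $(A_1,A_2)$ is Pfaffian with constant $c\neq 0$ if $\det A_1[B]\det A_2[B]=c$ for every common base $B$, and Pfaffian if this holds for some $c\ne 0$. Then the following hold. 1. For every disjoint $S$--$T$ path $P$ and every common base $B$ of $(A_1,A_2)$ with $P\subseteq B$, $$\operatorname{sgn}P=(-1)^k\det A_1[B]\,\det A_2[B].$$ 2. If $(S,T)$ is in the LGV position, then $(A_1,A_2)$ is Pfaffian, and it is Pfaffian with constant $(-1)^k\operatorname{sgn}P$ for every disjoint $S$--$T$ path $P$. 3. Let $l:E\to\mathbb{R}_{>0}$ be an edge length, and let $w:E^*\to\mathbb{R}$ be given by $w(e)=l(e)$ for $e\in E$ and $w(e)=0$ for $e\in E'$. Then the minimum of $l(P)=\sum_{e\in P}l(e)$ over the disjoint $S$--$T$ paths $P$ equals the minimum of $w(B)=\sum_{e\in B}w(e)$ over the common bases $B$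 of $(A_1,A_2)$ (one minimum exists if and only if the other does). Moreover, there is a bijection $\Phi$ from the set of shortest disjoint $S$--$T$ paths onto the set of minimum-weight common bases such that, for every shortest disjoint $S$--$T$ path $P$ and every minimum-weight common base $B$, $\Phi(P)=B$ if and only if $P\subseteq B$. -/

import Mathlib

namespace STPaths

section MatrixPairs

variable {R E : Type*} [Fintype R] [DecidableEq R]

/-- The determinant of the square submatrix `A[B]`, the columns of `B` being listed by `e`
(the ordering of the columns only affects the sign). -/
def subDet (A : Matrix R E ℚ) (B : Finset E) (e : R ≃ B) : ℚ :=
  (A.submatrix id (fun r => (e r : E))).det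

/-- `B` is a base of `A`: it has as many elements as `A` has rows, and `A[B]` is nonsingular. -/
def IsBase (A : Matrix R E ℚ) (B : Finset E) : Prop :=
  ∃ e : R ≃ B, subDet A B e ≠ 0

/-- `B` is a common base of the matrix pair `(A₁, A₂)`. -/
def IsCommonBase (A₁ A₂ : Matrix R E ℚ) (B : Finset E) : Prop :=
  IsBase A₁ B ∧ IsBase A₂ B

/-- Reordering the columns multiplies `det A[B]` by the sign of the reordering. -/
theorem subDet_eq_sign_mul (A : Matrix R E ℚ) (B : Finset E) (e f : R ≃ B) :
    subDet A B f = (Equiv.Perm.sign (f.trans e.symm) : ℤ) * subDet A B e := by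
  unfold subDet
  rw [← Matrix.det_permute']
  congr 1
  ext i j
  simp

/-- The product `det A₁[B] · det A₂[B]` does not depend on the common ordering of the columns. -/
theorem subDet_mul_subDet_eq (A₁ A₂ : Matrix R E ℚ) (B : Finset E) (e f : R ≃ B) :
    subDet A₁ B f * subDet A₂ B f = subDet A₁ B e * subDet A₂ B e := by
  rw [subDet_eq_sign_mul A₁ B e f, subDet_eq_sign_mul A₂ B e f]
  have h : ((Equiv.Perm.sign (f.trans e.symm) : ℤ) : ℚ) *
      ((Equiv.Perm.sign (f.trans e.symm) : ℤ) : ℚ) = 1 := by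
    rw [← Int.cast_mul, ← Units.val_mul, Int.units_mul_self]
    simp
  linear_combination (subDet A₁ B e * subDet A₂ B e) * h

/-- The pair `(A₁, A₂)` is Pfaffian with constant `c`. -/
def IsPfaffianWith (A₁ A₂ : Matrix R E ℚ) (c : ℚ) : Prop :=
  c ≠ 0 ∧ ∀ B : Finset E, IsCommonBase A₁ A₂ B →
    ∀ e : R ≃ B, subDet A₁ B e * subDet A₂ B e = c

/-- The pair `(A₁, A₂)` is Pfaffian. -/
def IsPfaffian (A₁ A₂ : Matrix R E ℚ) : Prop :=
  ∃ c : ℚ, IsPfaffianWith A₁ A₂ c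

/-- `B` is a common base of `(A₁, A₂)` of minimum weight with respect to the column weight `w`. -/
def IsMinWeightCommonBase (A₁ A₂ : Matrix R E ℚ) (w : E → ℝ) (B : Finset E) : Prop :=
  IsCommonBase A₁ A₂ B ∧
    ∀ B' : Finset E, IsCommonBase A₁ A₂ B' → ∑ j ∈ B, w j ≤ ∑ j ∈ B', w j

end MatrixPairs

section Incidence

/-- An orientation of a graph with vertex set `W`, edge set `E` and end map `ends`. -/
structure EdgeOrientation {W E : Type*} (ends : E → Sym2 W) where
  tail : E → W
  head : E → W
  ends_eq : ∀ e, s(tail e, head e) = ends e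

/-- The incidence matrix of an oriented graph: `+1` at the tail, `-1` at the head (the column
of a loop, if there is one, is zero). -/
def incidence {W E : Type*} [DecidableEq W] {ends : E → Sym2 W} (D : EdgeOrientation ends) :
    Matrix W E ℚ :=
  Matrix.of fun v e => (if v = D.tail e then 1 else 0) - (if v = D.head e then 1 else 0)

end Incidence

section Walks

/-- Walks in the undirected graph with vertex set `V`, edge set `E` and end map `ends`.
Parallel edges are allowed, so a walk records its edges. -/
inductive Walk {V E : Type*} (ends : E → Sym2 V) : V → V → Type _
  | nil (u : V) : Walk ends u u
  | cons {u v w : V} (e : E) (h : ends e = s(u, v)) (p : Walk ends v w) : Walk ends u w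

/-- The list of vertices visited by a walk. -/
def Walk.support {V E : Type*} {ends : E → Sym2 V} : {u v : V} → Walk ends u v → List V
  | _, _, .nil u => [u]
  | u, _, .cons _ _ p => u :: p.support

/-- The list of edges used by a walk. -/
def Walk.edges {V E : Type*} {ends : E → Sym2 V} : {u v : V} → Walk ends u v → List E
  | _, _, .nil _ => []
  | _, _, .cons e _ p => e :: p.edges

/-- A path is a walk that visits no vertex twice. -/
def Walk.IsPath {V E : Type*} {ends : E → Sym2 V} {u v : V} (p : Walk ends u v) : Prop :=
  p.support.Nodup

theorem Walk.start_mem {V E : Type*} {ends : E → Sym2 V} {u v : V} (p : Walk ends u v) :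
    u ∈ p.support := by
  cases p <;> simp [Walk.support]

theorem Walk.end_mem {V E : Type*} {ends : E → Sym2 V} {u v : V} (p : Walk ends u v) :
    v ∈ p.support := by
  induction p with
  | nil u => simp [Walk.support]
  | cons e h p ih => simp [Walk.support, ih]

/-- The ends of the edges of a walk are visited by the walk. -/
theorem Walk.mem_support_of_mem_edges {V E : Type*} {ends : E → Sym2 V} {u v : V}
    (p : Walk ends u v) {e : E} (he : e ∈ p.edges) {x : V} (hx : x ∈ ends e) :
    x ∈ p.support := by
  induction p with
  | nil u => simp [Walk.edges] at he
  | cons f h p ih =>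
    simp only [Walk.edges, List.mem_cons] at he
    rcases he with rfl | he
    · rw [h, Sym2.mem_iff] at hx
      rcases hx with rfl | rfl
      · simp [Walk.support]
      · simp [Walk.support, p.start_mem]
    · simp [Walk.support, ih he]

end Walks

section Paths

variable {V E : Type*} {k : ℕ}

/-- The edge set `P` is the union of pairwise vertex-disjoint paths, the `i`-th of which
goes from `s i` to `t (σ i)`. -/
def Links (ends : E → Sym2 V) (s t : Fin k → V) (σ : Equiv.Perm (Fin k))
    (P : Finset E) : Prop :=
  ∃ p : ∀ i, Walk ends (s i) (t (σ i)),
    (∀ i, (p i).IsPath) ∧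
    (∀ i j, i ≠ j → ∀ v, v ∈ (p i).support → v ∉ (p j).support) ∧
    ∀ e : E, e ∈ P ↔ ∃ i, e ∈ (p i).edges

/-- `P` is a disjoint `S`–`T` path, where `S = {s i}` and `T = {t i}`. -/
def IsDisjointPath (ends : E → Sym2 V) (s t : Fin k → V) (P : Finset E) : Prop :=
  ∃ σ, Links ends s t σ P

/-- The permutation realized by a disjoint `S`–`T` path is determined by its edge set. -/
theorem Links.unique {ends : E → Sym2 V} {s t : Fin k → V} {σ τ : Equiv.Perm (Fin k)}
    {P : Finset E} (hσ : Links ends s t σ P) (hτ : Links ends s t τ P) : σ = τ := by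
  obtain ⟨p, -, hd, hp⟩ := hσ
  obtain ⟨q, -, -, hq⟩ := hτ
  have key : ∀ (i : Fin k) (u v : V) (r : Walk ends u v), u ∈ (p i).support →
      (∀ e ∈ r.edges, ∃ j, e ∈ (p j).edges) → v ∈ (p i).support := by
    intro i u v r
    induction r with
    | nil u => exact fun h _ => h
    | @cons a b c e hab r ih =>
      intro ha he
      refine ih ?_ fun f hf => he f (by simp [Walk.edges, hf])
      obtain ⟨j, hj⟩ := he e (by simp [Walk.edges])
      have h1 : a ∈ (p j).support := (p j).mem_support_of_mem_edges hj (by simp [hab])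
      have h2 : b ∈ (p j).support := (p j).mem_support_of_mem_edges hj (by simp [hab])
      by_cases hij : i = j
      · exact hij ▸ h2
      · exact absurd h1 (hd i j hij a ha)
  ext1 i
  have h1 : t (τ i) ∈ (p i).support :=
    key i _ _ (q i) (p i).start_mem fun e he => (hp e).1 ((hq e).2 ⟨i, he⟩)
  have h2 : ∀ j, σ j = τ i → t (τ i) ∈ (p j).support := by
    intro j hj
    rw [← hj]
    exact (p j).end_mem
  by_contra hne
  refine hd i (σ.symm (τ i)) (fun h => hne ?_) _ h1 (h2 _ (by simp))
  rwa [Equiv.eq_symm_apply] at h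

open Classical in
/-- The permutation `σ_P` of a disjoint `S`–`T` path `P` (the identity if `P` is not one). -/
noncomputable def pathPerm (ends : E → Sym2 V) (s t : Fin k → V) (P : Finset E) :
    Equiv.Perm (Fin k) :=
  if h : ∃ σ, Links ends s t σ P then h.choose else 1

theorem pathPerm_eq {ends : E → Sym2 V} {s t : Fin k → V} {σ : Equiv.Perm (Fin k)}
    {P : Finset E} (h : Links ends s t σ P) : pathPerm ends s t P = σ := by
  have h' : ∃ σ, Links ends s t σ P := ⟨σ, h⟩
  unfold pathPerm
  rw [dif_pos h']
  exact h'.choose_spec.unique h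

/-- The sign of a disjoint `S`–`T` path, as a rational number. -/
noncomputable def pathSign (ends : E → Sym2 V) (s t : Fin k → V) (P : Finset E) : ℚ :=
  ((Equiv.Perm.sign (pathPerm ends s t P) : ℤ) : ℚ)

/-- `(S, T)` is in the LGV position: all disjoint `S`–`T` paths have the same sign. -/
def LGVPosition (ends : E → Sym2 V) (s t : Fin k → V) : Prop :=
  ∀ P Q : Finset E, IsDisjointPath ends s t P → IsDisjointPath ends s t Q →
    pathSign ends s t P = pathSign ends s t Q

/-- `P` is a disjoint `S`–`T` path of minimum total length. -/
def IsShortestDisjointPath (ends : E → Sym2 V) (s t : Fin k → V) (l : E → ℝ)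
    (P : Finset E) : Prop :=
  IsDisjointPath ends s t P ∧
    ∀ Q : Finset E, IsDisjointPath ends s t Q → ∑ e ∈ P, l e ≤ ∑ e ∈ Q, l e

end Paths

section TuttePair

variable {V E : Type*} {k : ℕ}

/-- The set `V \ (S ∪ T)` of non-terminal vertices. -/
abbrev NonTerminal (s t : Fin k → V) : Type _ :=
  {v : V // (∀ i, v ≠ s i) ∧ ∀ i, v ≠ t i}

/-- The ends of the edges of the augmented graph `G*`. Its vertex set is `Option V`, with `none`
as the new vertex. Its edges are those of `G` and, for every non-terminal vertex, one new edge
joining that vertex to the new vertex. -/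
def starEnds (ends : E → Sym2 V) (s t : Fin k → V) : E ⊕ NonTerminal s t → Sym2 (Option V)
  | Sum.inl e => (ends e).map some
  | Sum.inr v => s(some (v : V), none)

/-- The matrix `A[S ∪ Ṽ, E*]` with `x = s`, and `A[T ∪ Ṽ, E*]` with `x = t`, where `A` is the
incidence matrix of the orientation `D` of `G*` and `Ṽ` the set of non-terminal vertices. The
first `k` rows are those of `x 0, x 1, …`; the rows of `Ṽ` are indexed alike in both matrices. -/
def tutteMatrix {ends : E → Sym2 V} [DecidableEq V] {s t : Fin k → V}
    (D : EdgeOrientation (starEnds ends s t)) (x : Fin k → V) :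
    Matrix (Fin k ⊕ NonTerminal s t) (E ⊕ NonTerminal s t) ℚ :=
  (incidence D).submatrix
    (Sum.elim (fun i => some (x i)) (fun v => some (v : V))) id

/-- The column weight: the length on edges of `G`, zero on the new edges. -/
def starWeight (s t : Fin k → V) (l : E → ℝ) : E ⊕ NonTerminal s t → ℝ :=
  Sum.elim l (fun _ => 0)

/-- An edge set of `G`, regarded as an edge set of `G*`. -/
def liftEdges (s t : Fin k → V) (P : Finset E) : Finset (E ⊕ NonTerminal s t) :=
  P.map Function.Embedding.inl

end TuttePair

end STPaths

/-! For a set `B` with as many edges as there are rows, a row-restricted incidence matrix is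
nonsingular on the columns `B` exactly when every component of `B` contains exactly one omitted
vertex. The matrix of `S` omits `T` and `v*`, that of `T` omits `S` and `v*`. A common base is
therefore a spanning forest in which one tree contains `v*` and no terminal, and every other tree
contains exactly one source and one target. The paths joining these pairs form a disjoint path
inside the base (`exists_isDisjointPath_of_isCommonBase`). Conversely, a disjoint path becomes a
common base once each avoided vertex is attached to `v*` (`isCommonBase_extendToBase`).

The sign comes from a row transformation taking `A₁[B]` to `A₂[B]`: its determinant depends only on
the pairing of sources with targets and equals `(-1)^k sgn σ` (`subDet_mul_subDet_of_edgeConn`).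
Since `det A₁[B] = ±1`, this is also the product of the two determinants.

New edges have weight zero and old ones positive weight, so a lightest common base has no old edges
beyond the path it contains; `eq_extendToBase` shows that this path determines the base. -/

namespace STPaths

/-! ### Components of an edge set -/

section Connectivity

variable {W F : Type*} {ends : F → Sym2 W}

/-- Two vertices are joined by a sequence of edges of `B`. -/
def EdgeConn (ends : F → Sym2 W) (B : Finset F) : W → W → Prop :=
  Relation.ReflTransGen fun u v => ∃ f ∈ B, ends f = s(u, v)

theorem EdgeConn.refl {B : Finset F} (u : W) : EdgeConn ends B u u :=
  Relation.ReflTransGen.refl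

theorem EdgeConn.trans {B : Finset F} {u v w : W} (h : EdgeConn ends B u v)
    (h' : EdgeConn ends B v w) : EdgeConn ends B u w :=
  Relation.ReflTransGen.trans h h'

theorem EdgeConn.symm {B : Finset F} {u v : W} (h : EdgeConn ends B u v) :
    EdgeConn ends B v u := by
  induction h with
  | refl => exact EdgeConn.refl _
  | tail _ h ih =>
    obtain ⟨f, hf, hab⟩ := h
    exact Relation.ReflTransGen.head ⟨f, hf, by rw [hab, Sym2.eq_swap]⟩ ih

theorem EdgeConn.of_edge {B : Finset F} {f : F} (hf : f ∈ B) {u v : W}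
    (h : ends f = s(u, v)) : EdgeConn ends B u v :=
  Relation.ReflTransGen.single ⟨f, hf, h⟩

/-- A function with equal values at the two ends of each edge is constant on components. -/
theorem EdgeConn.apply_eq {K : Type*} {B : Finset F} (D : EdgeOrientation ends) {Y : W → K}
    (hY : ∀ f ∈ B, Y (D.tail f) = Y (D.head f)) {u v : W} (h : EdgeConn ends B u v) :
    Y u = Y v := by
  induction h with
  | refl => rfl
  | tail _ h ih =>
    obtain ⟨f, hf, hab⟩ := h
    rw [← D.ends_eq f, Sym2.eq_iff] at hab
    have := hY f hf
    rcases hab with ⟨h1, h2⟩ | ⟨h1, h2⟩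
    · rw [ih, ← h1, ← h2, this]
    · rw [ih, ← h1, ← h2, this]

end Connectivity

section IncidenceMap

variable {W F R : Type*} [DecidableEq W] {ends : F → Sym2 W}

/-- The incidence matrix over an arbitrary ring, restricted to the rows `row` and to the
columns `col`. -/
def incidenceRows (K : Type*) [Ring K] (D : EdgeOrientation ends) (row : R → W) (col : R → F) :
    Matrix R R K :=
  Matrix.of fun r c =>
    (if row r = D.tail (col c) then 1 else 0) - (if row r = D.head (col c) then 1 else 0)

theorem map_incidenceRows {K L : Type*} [Ring K] [Ring L] (φ : K →+* L) (D : EdgeOrientation ends)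
    (row : R → W) (col : R → F) :
    (incidenceRows K D row col).map φ = incidenceRows L D row col := by
  ext r c
  simp only [incidenceRows, Matrix.map_apply, Matrix.of_apply, map_sub]
  split_ifs <;> simp

end IncidenceMap

/-! ### Nonsingular submatrices of an incidence matrix -/

section IncidenceRows

variable {W F R : Type*} [DecidableEq W] [Fintype R] [DecidableEq R]
  {ends : F → Sym2 W}

/-- Row combinations are potentials on the vertices that vanish at omitted rows, and the product
with the matrix is the potential difference along each edge. All the determinant criteria below rest
on this. -/
theorem vecMul_incidenceRows {K : Type*} [CommRing K] (D : EdgeOrientation ends) {row : R → W}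
    (hrow : Function.Injective row) (col : R → F) (Y : W → K)
    (hY : ∀ w, w ∉ Set.range row → Y w = 0) (c : R) :
    Matrix.vecMul (Y ∘ row) (incidenceRows K D row col) c =
      Y (D.tail (col c)) - Y (D.head (col c)) := by
  have key : ∀ w, ∑ r, Y (row r) * (if row r = w then (1 : K) else 0) = Y w := by
    intro w
    by_cases hw : w ∈ Set.range row
    · obtain ⟨r, rfl⟩ := hw
      simp [hrow.eq_iff]
    · rw [hY w hw]
      refine Finset.sum_eq_zero fun r _ => ?_
      rw [if_neg fun h => hw ⟨r, h⟩, mul_zero]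
  simp only [Matrix.vecMul, dotProduct, incidenceRows, Matrix.of_apply, Function.comp, mul_sub,
    Finset.sum_sub_distrib, key]

/-- If every component meets the set of omitted rows, then the matrix is nonsingular, over
every field. -/
theorem det_incidenceRows_ne_zero (K : Type*) [Field K] (D : EdgeOrientation ends) {row : R → W}
    (hrow : Function.Injective row) {B : Finset F} (e : R ≃ B)
    (h : ∀ w, ∃ z, z ∉ Set.range row ∧ EdgeConn ends B w z) :
    (incidenceRows K D row fun r => (e r : F)).det ≠ 0 := by
  intro h0
  obtain ⟨y, hy0, hy⟩ := Matrix.exists_vecMul_eq_zero_iff.2 h0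
  apply hy0
  -- A left kernel vector, extended by zero, is constant on components, hence zero because each
  -- component contains an omitted vertex.
  have hYrow : Function.extend row y (0 : W → K) ∘ row = y := funext fun r => hrow.extend_apply y 0 r
  have hYz : ∀ w, w ∉ Set.range row → Function.extend row y (0 : W → K) w = 0 := fun w hw =>
    Function.extend_apply' y _ w hw
  have hYe : ∀ f ∈ B, Function.extend row y (0 : W → K) (D.tail f) =
      Function.extend row y (0 : W → K) (D.head f) := by
    intro f hf
    have := vecMul_incidenceRows D hrow (fun r => (e r : F)) _ hYz (e.symm ⟨f, hf⟩)
    rw [hYrow, hy] at this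
    simpa [sub_eq_zero] using this.symm
  ext r
  obtain ⟨z, hz, hc⟩ := h (row r)
  rw [← hYrow, Function.comp, hc.apply_eq D hYe, hYz z hz, Pi.zero_apply]

/-- The indicator of a component without omitted vertices would be a nonzero left kernel vector. -/
theorem edgeConn_of_det_ne_zero {K : Type*} [Field K] (D : EdgeOrientation ends) {row : R → W}
    (hrow : Function.Injective row) {B : Finset F} (e : R ≃ B)
    (h : (incidenceRows K D row fun r => (e r : F)).det ≠ 0) (w : W) :
    ∃ z, z ∉ Set.range row ∧ EdgeConn ends B w z := by
  classical
  by_contra! hw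
  let Y : W → K := fun v => if EdgeConn ends B w v then 1 else 0
  have hYz : ∀ v, v ∉ Set.range row → Y v = 0 := fun v hv => if_neg (hw v hv)
  refine h (Matrix.exists_vecMul_eq_zero_iff.1 ⟨Y ∘ row, ?_, ?_⟩)
  · have : w ∈ Set.range row := by
      by_contra hr
      exact hw w hr (EdgeConn.refl w)
    obtain ⟨r, rfl⟩ := this
    intro h0
    have := congrFun h0 r
    simp [Y, EdgeConn.refl] at this
  · ext c
    rw [vecMul_incidenceRows D hrow _ Y hYz, Pi.zero_apply, sub_eq_zero]
    have hth : EdgeConn ends B (D.tail (e c)) (D.head (e c)) :=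
      EdgeConn.of_edge (e c).2 (D.ends_eq _).symm
    have : EdgeConn ends B w (D.tail (e c)) ↔ EdgeConn ends B w (D.head (e c)) :=
      ⟨fun h => h.trans hth, fun h => h.trans hth.symm⟩
    simp only [Y, this]

/-- Nonsingularity gives a potential, zero at omitted vertices, whose differences along `B` cancel
those of the indicator of `z`. The sum of the two is constant on components, yet equals `1` at `z`
and `0` at any other omitted vertex. -/
theorem eq_of_edgeConn_of_det_ne_zero {K : Type*} [Field K] (D : EdgeOrientation ends)
    {row : R → W} (hrow : Function.Injective row) {B : Finset F} (e : R ≃ B)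
    (h : (incidenceRows K D row fun r => (e r : F)).det ≠ 0) {z z' : W}
    (hz : z ∉ Set.range row) (hz' : z' ∉ Set.range row) (hc : EdgeConn ends B z z') :
    z = z' := by
  by_contra hne
  set M := incidenceRows K D row fun r => (e r : F)
  let I : W → K := Pi.single z 1
  let b : R → K := fun c => I (D.head (e c)) - I (D.tail (e c))
  have hM : IsUnit M.det := isUnit_iff_ne_zero.2 h
  set y : R → K := Matrix.vecMul b M⁻¹
  have hy : Matrix.vecMul y M = b := by
    rw [Matrix.vecMul_vecMul, Matrix.nonsing_inv_mul _ hM, Matrix.vecMul_one]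
  have hYrow : Function.extend row y (0 : W → K) ∘ row = y := funext fun r => hrow.extend_apply y 0 r
  have hYz : ∀ w, w ∉ Set.range row → Function.extend row y (0 : W → K) w = 0 := fun w hw =>
    Function.extend_apply' y _ w hw
  have := hc.apply_eq D (Y := fun w => Function.extend row y (0 : W → K) w + I w) (by
    intro f hf
    have := vecMul_incidenceRows D hrow (fun r => (e r : F)) _ hYz (e.symm ⟨f, hf⟩)
    rw [hYrow] at this
    change Matrix.vecMul y M _ = _ at this
    rw [hy] at this
    simp only [b, Equiv.apply_symm_apply] at this
    linear_combination -this)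
  simp [hYz z hz, hYz z' hz', I, Ne.symm hne] at this

/-- Nonsingular square submatrices of an incidence matrix are unimodular. -/
theorem det_incidenceRows_sq (D : EdgeOrientation ends) {row : R → W}
    (hrow : Function.Injective row) {B : Finset F} (e : R ≃ B)
    (h : (incidenceRows ℚ D row fun r => (e r : F)).det ≠ 0) :
    (incidenceRows ℚ D row fun r => (e r : F)).det *
      (incidenceRows ℚ D row fun r => (e r : F)).det = 1 := by
  have hc := edgeConn_of_det_ne_zero D hrow e h
  have hu : IsUnit (incidenceRows ℤ D row fun r => (e r : F)).det := by
    rw [Int.isUnit_iff_natAbs_eq]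
    by_contra hne
    -- The connectivity criterion does not depend on the field, so the integer determinant is
    -- nonzero modulo every prime.
    obtain ⟨p, hp, hd⟩ := Nat.exists_prime_and_dvd hne
    have := Fact.mk hp
    refine det_incidenceRows_ne_zero (ZMod p) D hrow e hc ?_
    rw [← map_incidenceRows (Int.castRingHom (ZMod p)), ← RingHom.mapMatrix_apply,
      ← RingHom.map_det]
    exact (ZMod.intCast_zmod_eq_zero_iff_dvd _ p).2 (Int.natCast_dvd.2 hd)
  rw [← map_incidenceRows (Int.castRingHom ℚ), ← RingHom.mapMatrix_apply, ← RingHom.map_det,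
    ← map_mul]
  rcases Int.isUnit_iff.1 hu with h | h <;> rw [h] <;> norm_num

end IncidenceRows

/-! ### Walks and paths inside an edge set -/

section WalkLemmas

variable {V E : Type*} {ends : E → Sym2 V}

theorem Walk.edgeConn {Q : Finset E} {u v : V} (p : Walk ends u v) (h : ∀ e ∈ p.edges, e ∈ Q)
    {x : V} (hx : x ∈ p.support) : EdgeConn ends Q u x := by
  induction p with
  | nil u =>
    simp only [Walk.support, List.mem_singleton] at hx
    exact hx ▸ EdgeConn.refl _
  | cons e he p ih =>
    simp only [Walk.support, List.mem_cons, Walk.edges] at hx h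
    rcases hx with rfl | hx
    · exact EdgeConn.refl _
    · exact (EdgeConn.of_edge (h e (Or.inl rfl)) he).trans (ih (fun f hf => h f (Or.inr hf)) hx)

theorem Walk.exists_suffix {u v : V} (p : Walk ends u v) {x : V} (hx : x ∈ p.support) :
    ∃ q : Walk ends x v, q.support <:+ p.support ∧ q.edges <:+ p.edges := by
  induction p with
  | nil u =>
    simp only [Walk.support, List.mem_singleton] at hx
    subst hx
    exact ⟨.nil _, List.suffix_refl _, List.suffix_refl _⟩
  | cons e he p ih =>
    simp only [Walk.support, List.mem_cons] at hx
    rcases hx with rfl | hx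
    · exact ⟨.cons e he p, List.suffix_refl _, List.suffix_refl _⟩
    · obtain ⟨q, h1, h2⟩ := ih hx
      exact ⟨q, h1.trans (List.suffix_cons _ _), h2.trans (List.suffix_cons _ _)⟩

theorem EdgeConn.exists_path {Q : Finset E} {u v : V} (h : EdgeConn ends Q u v) :
    ∃ p : Walk ends u v, p.IsPath ∧ ∀ e ∈ p.edges, e ∈ Q := by
  induction h using Relation.ReflTransGen.head_induction_on with
  | refl => exact ⟨.nil _, by simp [Walk.IsPath, Walk.support], by simp [Walk.edges]⟩
  | @head a b hab _ ih =>
    obtain ⟨p, hp, hpe⟩ := ih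
    obtain ⟨f, hf, hab⟩ := hab
    by_cases ha : a ∈ p.support
    · obtain ⟨q, h1, h2⟩ := p.exists_suffix ha
      exact ⟨q, hp.sublist h1.sublist, fun e he => hpe e (h2.subset he)⟩
    · refine ⟨.cons f hab p, List.nodup_cons.2 ⟨ha, hp⟩, ?_⟩
      simp only [Walk.edges, List.mem_cons]
      rintro e (rfl | he)
      exacts [hf, hpe e he]

theorem Walk.length_support {u v : V} (p : Walk ends u v) :
    p.support.length = p.edges.length + 1 := by
  induction p with
  | nil u => rfl
  | cons e he p ih => simp [Walk.support, Walk.edges, ih]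

theorem Walk.IsPath.nodup_edges {u v : V} {p : Walk ends u v} (hp : p.IsPath) :
    p.edges.Nodup := by
  induction p with
  | nil u => simp [Walk.edges]
  | @cons a b c e he p ih =>
    obtain ⟨ha, hp⟩ := List.nodup_cons.1 hp
    refine List.nodup_cons.2 ⟨fun h => ha ?_, ih hp⟩
    exact p.mem_support_of_mem_edges h (by rw [he]; simp)

end WalkLemmas

/-! ### The augmented graph, its omitted vertices and its weights -/

section TuttePairLemmas

variable {V E : Type*} {ends : E → Sym2 V} {k : ℕ} {s t : Fin k → V}

/-- The row indices of the matrix of a terminal sequence `x`, as vertices of `G*`. -/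
def rowVertex (s t x : Fin k → V) : Fin k ⊕ NonTerminal s t → Option V :=
  Sum.elim (fun i => some (x i)) (fun v => some (v : V))

theorem rowVertex_injective {x : Fin k → V} (hx : Function.Injective x)
    (h : ∀ i (v : NonTerminal s t), (v : V) ≠ x i) :
    Function.Injective (rowVertex s t x) := by
  rintro (i | v) (j | w) hij
  · simpa [rowVertex, hx.eq_iff] using hij
  · exact absurd (Option.some.inj hij).symm (h i w)
  · exact absurd (Option.some.inj hij) (h j v)
  · simpa [rowVertex, Subtype.ext_iff] using hij

theorem none_notMem_range_rowVertex (x : Fin k → V) :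
    (none : Option V) ∉ Set.range (rowVertex s t x) := by
  rintro ⟨i | v, h⟩ <;> simp [rowVertex] at h

theorem source_injective (hs : Function.Injective s) : Function.Injective (rowVertex s t s) :=
  rowVertex_injective hs fun i v => v.2.1 i

theorem target_injective (ht : Function.Injective t) : Function.Injective (rowVertex s t t) :=
  rowVertex_injective ht fun i v => v.2.2 i

theorem target_notMem_range (hst : ∀ i j, s i ≠ t j) (j : Fin k) :
    some (t j) ∉ Set.range (rowVertex s t s) := by
  rintro ⟨i | v, h⟩
  · exact hst i j (Option.some.inj h)
  · exact v.2.2 j (Option.some.inj h)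

theorem source_notMem_range (hst : ∀ i j, s i ≠ t j) (i : Fin k) :
    some (s i) ∉ Set.range (rowVertex s t t) := by
  rintro ⟨j | v, h⟩
  · exact hst i j (Option.some.inj h).symm
  · exact v.2.1 i (Option.some.inj h)

theorem notMem_range_source {z : Option V} (hz : z ∉ Set.range (rowVertex s t s)) :
    z = none ∨ ∃ j, z = some (t j) := by
  rcases z with _ | v
  · exact Or.inl rfl
  · right
    by_contra! h
    by_cases hv : ∃ i, v = s i
    · obtain ⟨i, rfl⟩ := hv
      exact hz ⟨Sum.inl i, rfl⟩
    · exact hz ⟨Sum.inr ⟨v, fun i hi => hv ⟨i, hi⟩, fun i hi => h i (hi ▸ rfl)⟩, rfl⟩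

theorem EdgeConn.star {P : Finset E} {B : Finset (E ⊕ NonTerminal s t)}
    (hPB : liftEdges s t P ⊆ B) {u v : V} (h : EdgeConn ends P u v) :
    EdgeConn (starEnds ends s t) B (some u) (some v) := by
  induction h with
  | refl => exact EdgeConn.refl _
  | tail _ h ih =>
    obtain ⟨f, hf, hab⟩ := h
    refine ih.trans (EdgeConn.of_edge (f := Sum.inl f) (hPB ?_) ?_)
    · simpa [liftEdges] using hf
    · simp [starEnds, hab]

/-- Every new edge ends at `v*`, so a component avoiding `v*` is connected by old edges alone. -/
theorem EdgeConn.of_star {B : Finset (E ⊕ NonTerminal s t)} {u : V} {z : Option V}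
    (h : EdgeConn (starEnds ends s t) B (some u) z)
    (hn : ¬ EdgeConn (starEnds ends s t) B (some u) none) :
    ∃ v, z = some v ∧ EdgeConn ends B.toLeft u v := by
  induction h with
  | refl => exact ⟨u, rfl, EdgeConn.refl _⟩
  | @tail a b hua h ih =>
    obtain ⟨v, rfl, hv⟩ := ih
    obtain ⟨f | x, hf, hab⟩ := h
    · rcases b with _ | b
      · exact absurd (EdgeConn.trans hua (EdgeConn.of_edge hf hab)) hn
      · refine ⟨b, rfl, hv.trans (EdgeConn.of_edge (f := f) (by simpa using hf) ?_)⟩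
        have hab' : (ends f).map some = (s(v, b)).map some := hab
        exact Sym2.map.injective (Option.some_injective V) hab'
    · have hb : b = none ∨ b = some v := by
        simp only [starEnds, Sym2.eq_iff] at hab
        grind
      rcases hb with rfl | rfl
      · exact absurd (EdgeConn.trans hua (EdgeConn.of_edge hf hab)) hn
      · exact ⟨v, rfl, hv⟩

theorem Links.edgeConn {σ : Equiv.Perm (Fin k)} {P : Finset E} (h : Links ends s t σ P)
    (i : Fin k) : EdgeConn ends P (s i) (t (σ i)) := by
  obtain ⟨p, -, -, hP⟩ := h
  exact (p i).edgeConn (fun e he => (hP e).2 ⟨i, he⟩) (p i).end_mem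

theorem liftEdges_subset_iff {P : Finset E} {B : Finset (E ⊕ NonTerminal s t)} :
    liftEdges s t P ⊆ B ↔ P ⊆ B.toLeft := by
  simp [liftEdges, Finset.subset_iff]

theorem sum_starWeight (l : E → ℝ) (B : Finset (E ⊕ NonTerminal s t)) :
    ∑ f ∈ B, starWeight s t l f = ∑ f ∈ B.toLeft, l f := by
  conv_lhs => rw [← Finset.toLeft_disjSum_toRight (u := B)]
  simp [Finset.sum_disjSum, starWeight]

theorem eq_of_subset_of_sum_le {l : E → ℝ} (hl : ∀ e, 0 < l e) {P Q : Finset E} (hPQ : P ⊆ Q)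
    (h : ∑ e ∈ Q, l e ≤ ∑ e ∈ P, l e) : P = Q := by
  by_contra hne
  obtain ⟨f, hf, hfP⟩ := Finset.exists_of_ssubset (hPQ.ssubset_of_ne hne)
  exact absurd h (not_le.2 (Finset.sum_lt_sum_of_subset hPQ hf hfP (hl f) fun j _ _ => (hl j).le))

theorem sum_liftEdges_le {l : E → ℝ} (hl : ∀ e, 0 < l e) {P : Finset E}
    {B : Finset (E ⊕ NonTerminal s t)} (h : liftEdges s t P ⊆ B) :
    ∑ e ∈ P, l e ≤ ∑ f ∈ B, starWeight s t l f := by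
  rw [sum_starWeight]
  exact Finset.sum_le_sum_of_subset_of_nonneg (liftEdges_subset_iff.1 h) fun j _ _ => (hl j).le

variable [DecidableEq V]

theorem subDet_tutteMatrix [Fintype V] (D : EdgeOrientation (starEnds ends s t)) (x : Fin k → V)
    (B : Finset (E ⊕ NonTerminal s t)) (e : (Fin k ⊕ NonTerminal s t) ≃ B) :
    subDet (tutteMatrix D x) B e =
      (incidenceRows ℚ D (rowVertex s t x) fun r => (e r : E ⊕ NonTerminal s t)).det := rfl

end TuttePairLemmas

/-! ### Common bases and disjoint paths -/

section CommonBases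

variable {V E : Type*} [Fintype V] [DecidableEq V] {ends : E → Sym2 V} {k : ℕ} {s t : Fin k → V}

/-- The links between the terminals in a common base determine the product of the two
determinants. -/
theorem subDet_mul_subDet_of_edgeConn (hs : Function.Injective s) (ht : Function.Injective t)
    (hst : ∀ i j, s i ≠ t j) (D : EdgeOrientation (starEnds ends s t))
    {B : Finset (E ⊕ NonTerminal s t)} (e : (Fin k ⊕ NonTerminal s t) ≃ B)
    (h1 : subDet (tutteMatrix D s) B e ≠ 0) {σ : Equiv.Perm (Fin k)}
    (hσ : ∀ i, EdgeConn (starEnds ends s t) B (some (s i)) (some (t (σ i)))) :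
    subDet (tutteMatrix D s) B e * subDet (tutteMatrix D t) B e =
      (-1) ^ k * ((Equiv.Perm.sign σ : ℤ) : ℚ) := by
  classical
  have hsi := source_injective (t := t) hs
  rw [subDet_tutteMatrix] at h1
  have hsep : ∀ {z z'}, z ∉ Set.range (rowVertex s t s) → z' ∉ Set.range (rowVertex s t s) →
      EdgeConn (starEnds ends s t) B z z' → z = z' :=
    fun hz hz' => eq_of_edgeConn_of_det_ne_zero D hsi e h1 hz hz'
  have hiff : ∀ i j, EdgeConn (starEnds ends s t) B (some (t j)) (some (s i)) ↔ σ i = j := by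
    intro i j
    constructor
    · intro h
      have := hsep (target_notMem_range hst j) (target_notMem_range hst (σ i)) (h.trans (hσ i))
      exact (ht (Option.some.inj this)).symm
    · rintro rfl
      exact (hσ i).symm
  -- Subtracting the indicator of the component of `t j` leaves all differences along `B` unchanged,
  -- but makes the potential vanish at every vertex omitted from the source matrix, since `t j` is
  -- the only one in its component.
  let Y : Fin k ⊕ NonTerminal s t → Option V → ℚ := Sum.elim
    (fun j w => (if w = some (t j) then 1 else 0) -
      if EdgeConn (starEnds ends s t) B (some (t j)) w then 1 else 0)
    (fun v w => if w = some (v : V) then 1 else 0)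
  let X : Matrix (Fin k ⊕ NonTerminal s t) (Fin k ⊕ NonTerminal s t) ℚ :=
    Matrix.of fun r => Y r ∘ rowVertex s t s
  have hY : ∀ r w, w ∉ Set.range (rowVertex s t s) → Y r w = 0 := by
    rintro (j | v) w hw
    · by_cases hwt : w = some (t j)
      · subst hwt
        simp [Y, EdgeConn.refl]
      · have : ¬ EdgeConn (starEnds ends s t) B (some (t j)) w := fun h =>
          hwt (hsep (target_notMem_range hst j) hw h).symm
        simp [Y, hwt, this]
    · have : w ≠ some (v : V) := by
        rintro rfl
        exact hw ⟨Sum.inr v, rfl⟩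
      simp [Y, this]
  have hX : X * (incidenceRows ℚ D (rowVertex s t s) fun r => (e r : E ⊕ NonTerminal s t)) =
      incidenceRows ℚ D (rowVertex s t t) fun r => (e r : E ⊕ NonTerminal s t) := by
    ext r c
    rw [Matrix.mul_apply_eq_vecMul]
    change Matrix.vecMul (Y r ∘ rowVertex s t s) _ c = _
    rw [vecMul_incidenceRows D hsi _ _ (hY r)]
    rcases r with j | v
    · have hth : EdgeConn (starEnds ends s t) B (D.tail (e c)) (D.head (e c)) :=
        EdgeConn.of_edge (e c).2 (D.ends_eq _).symm
      have : EdgeConn (starEnds ends s t) B (some (t j)) (D.tail (e c)) ↔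
          EdgeConn (starEnds ends s t) B (some (t j)) (D.head (e c)) :=
        ⟨fun h => h.trans hth, fun h => h.trans hth.symm⟩
      simp only [Y, Sum.elim_inl, this, incidenceRows, Matrix.of_apply, rowVertex,
        @eq_comm _ (some (t j))]
      ring
    · simp only [Y, Sum.elim_inr, incidenceRows, Matrix.of_apply, rowVertex,
        @eq_comm _ (some (v : V))]
  -- The component of `t j` contains exactly one source, the one that `σ` sends to `j`; this gives
  -- the negated permutation block.
  have hblocks : X = Matrix.fromBlocks (-(σ.toPEquiv.toMatrix : Matrix _ _ ℚ).transpose)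
      (Matrix.of fun j (v : NonTerminal s t) => Y (Sum.inl j) (some (v : V))) 0 1 := by
    ext (j | v) (i | w)
    · have hne : s i ≠ t j := hst i j
      simp [X, Y, rowVertex, hiff, hne, PEquiv.toMatrix_apply, Equiv.toPEquiv_apply,
        Equiv.eq_symm_apply, eq_comm]
    · simp [X, rowVertex]
    · simp [X, Y, rowVertex, (v.2.1 i).symm]
    · simp [X, Y, rowVertex, Matrix.one_apply, Subtype.ext_iff, eq_comm]
  have hdet : X.det = (-1) ^ k * ((Equiv.Perm.sign σ : ℤ) : ℚ) := by
    rw [hblocks, Matrix.det_fromBlocks_zero₂₁, Matrix.det_one, mul_one, Matrix.det_neg,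
      Matrix.det_transpose, Matrix.det_permutation, Fintype.card_fin]
  rw [subDet_tutteMatrix, subDet_tutteMatrix, ← hX, Matrix.det_mul, hdet]
  linear_combination ((-1) ^ k * ((Equiv.Perm.sign σ : ℤ) : ℚ)) * det_incidenceRows_sq D hsi e h1

/-- The two bases may be witnessed by different column orders; reordering changes only signs, so any
one order serves both. -/
theorem exists_det_ne_zero_of_isCommonBase (D : EdgeOrientation (starEnds ends s t))
    {B : Finset (E ⊕ NonTerminal s t)}
    (hB : IsCommonBase (tutteMatrix D s) (tutteMatrix D t) B)
    (e : (Fin k ⊕ NonTerminal s t) ≃ B) :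
    subDet (tutteMatrix D s) B e ≠ 0 ∧ subDet (tutteMatrix D t) B e ≠ 0 := by
  obtain ⟨⟨e₁, h₁⟩, ⟨e₂, h₂⟩⟩ := hB
  rw [subDet_eq_sign_mul _ _ e₁ e, subDet_eq_sign_mul _ _ e₂ e]
  exact ⟨mul_ne_zero (by simp) h₁, mul_ne_zero (by simp) h₂⟩

/-- Each common base contains a disjoint path. -/
theorem exists_isDisjointPath_of_isCommonBase
    (hs : Function.Injective s) (ht : Function.Injective t)
    (hst : ∀ i j, s i ≠ t j) (D : EdgeOrientation (starEnds ends s t))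
    {B : Finset (E ⊕ NonTerminal s t)}
    (hB : IsCommonBase (tutteMatrix D s) (tutteMatrix D t) B) :
    ∃ P, IsDisjointPath ends s t P ∧ liftEdges s t P ⊆ B := by
  classical
  obtain ⟨e, -⟩ := hB.1
  obtain ⟨h1, h2⟩ := exists_det_ne_zero_of_isCommonBase D hB e
  rw [subDet_tutteMatrix] at h1 h2
  -- The target matrix separates the sources from each other and from `v*`; the source matrix then
  -- provides each source with a target in its component.
  have hsep : ∀ {z z'}, z ∉ Set.range (rowVertex s t t) → z' ∉ Set.range (rowVertex s t t) →
      EdgeConn (starEnds ends s t) B z z' → z = z' :=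
    fun hz hz' => eq_of_edgeConn_of_det_ne_zero D (target_injective ht) e h2 hz hz'
  have hnone : ∀ i, ¬ EdgeConn (starEnds ends s t) B (some (s i)) none := fun i h =>
    Option.some_ne_none _
      (hsep (source_notMem_range hst i) (none_notMem_range_rowVertex t) h)
  have hss : ∀ i j, EdgeConn (starEnds ends s t) B (some (s i)) (some (s j)) → i = j :=
    fun i j h => hs (Option.some.inj
      (hsep (source_notMem_range hst i) (source_notMem_range hst j) h))
  have hex : ∀ i, ∃ j, EdgeConn ends B.toLeft (s i) (t j) := by
    intro i
    obtain ⟨z, hz, hc⟩ :=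
      edgeConn_of_det_ne_zero D (source_injective hs) e h1 (some (s i))
    rcases notMem_range_source hz with rfl | ⟨j, rfl⟩
    · exact absurd hc (hnone i)
    · obtain ⟨v, hv, hc'⟩ := hc.of_star (hnone i)
      exact ⟨j, Option.some.inj hv ▸ hc'⟩
  have hleft : liftEdges s t B.toLeft ⊆ B := by
    intro f hf
    obtain ⟨a, ha, rfl⟩ := Finset.mem_map.1 hf
    exact Finset.mem_toLeft.1 ha
  choose τ hτ using hex
  have hinj : Function.Injective τ := fun i j hij =>
    hss i j (((hτ i).trans (hij ▸ (hτ j).symm)).star hleft)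
  choose p hp hpe using fun i => (hτ i).exists_path
  refine ⟨Finset.univ.biUnion fun i => (p i).edges.toFinset,
    ⟨Equiv.ofBijective τ (Finite.injective_iff_bijective.1 hinj), p, hp, ?_, by simp⟩, ?_⟩
  · intro i j hij v hi hj
    have hi' := (p i).edgeConn (hpe i) hi
    have hj' := (p j).edgeConn (hpe j) hj
    exact hij (hss i j ((hi'.trans hj'.symm).star hleft))
  · refine Finset.Subset.trans (Finset.map_subset_map.2 ?_) hleft
    intro f hf
    simp only [Finset.mem_biUnion, List.mem_toFinset] at hf
    obtain ⟨i, -, hf⟩ := hf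
    exact hpe i f hf

open Classical in
/-- The disjoint path `P` together with the new edges at the vertices it avoids. -/
noncomputable def extendToBase (ends : E → Sym2 V) (s t : Fin k → V) (P : Finset E) :
    Finset (E ⊕ NonTerminal s t) :=
  P.disjSum (Finset.univ.filter fun v : NonTerminal s t => ∀ i, ¬ EdgeConn ends P (s i) v)

theorem toLeft_extendToBase (P : Finset E) : (extendToBase ends s t P).toLeft = P := by
  simp [extendToBase]

theorem card_vertices (hs : Function.Injective s) (ht : Function.Injective t)
    (hst : ∀ i j, s i ≠ t j) :
    Fintype.card V = k + (k + Fintype.card (NonTerminal s t)) := by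
  have hb : Function.Bijective
      (Sum.elim s (Sum.elim t Subtype.val) : Fin k ⊕ Fin k ⊕ NonTerminal s t → V) := by
    constructor
    · refine hs.sumElim (ht.sumElim Subtype.val_injective fun j v => (v.2.2 j).symm) ?_
      rintro i (j | v)
      exacts [hst i j, (v.2.1 i).symm]
    · intro v
      by_cases h1 : ∃ i, s i = v
      · exact ⟨Sum.inl h1.choose, h1.choose_spec⟩
      by_cases h2 : ∃ i, t i = v
      · exact ⟨Sum.inr (Sum.inl h2.choose), h2.choose_spec⟩
      · exact ⟨Sum.inr (Sum.inr ⟨v, fun i h => h1 ⟨i, h.symm⟩, fun i h => h2 ⟨i, h.symm⟩⟩), rfl⟩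
  simpa using (Fintype.card_of_bijective hb).symm

/-- The `k` disjoint paths cover `k` more vertices than they have edges, and each avoided vertex
contributes one new edge, so the total is `|V| - k`. -/
theorem card_extendToBase (hs : Function.Injective s) (ht : Function.Injective t)
    (hst : ∀ i j, s i ≠ t j) {P : Finset E} (hP : IsDisjointPath ends s t P) :
    (extendToBase ends s t P).card = k + Fintype.card (NonTerminal s t) := by
  classical
  obtain ⟨σ, p, hp, hd, hPe⟩ := hP
  let C : Finset V := Finset.univ.biUnion fun i => (p i).support.toFinset
  have hC : ∀ v, v ∈ C ↔ ∃ i, v ∈ (p i).support := by simp [C]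
  have hCcard : C.card = ∑ i, ((p i).edges.length + 1) := by
    rw [Finset.card_biUnion]
    · refine Finset.sum_congr rfl fun i _ => ?_
      rw [List.toFinset_card_of_nodup (hp i), Walk.length_support]
    · intro i _ j _ hij
      simp only [Finset.disjoint_left, List.mem_toFinset]
      exact hd i j hij
  have hPeq : P = Finset.univ.biUnion fun i => (p i).edges.toFinset := by
    ext f
    simp [hPe]
  have hPcard : P.card = ∑ i, (p i).edges.length := by
    rw [hPeq, Finset.card_biUnion]
    · exact Finset.sum_congr rfl fun i _ => List.toFinset_card_of_nodup (hp i).nodup_edges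
    · intro i _ j _ hij
      simp only [Finset.disjoint_left, List.mem_toFinset]
      intro f hi hj
      obtain ⟨x, hx⟩ : ∃ x, x ∈ ends f := ⟨_, Sym2.out_fst_mem _⟩
      exact hd i j hij x ((p i).mem_support_of_mem_edges hi hx)
        ((p j).mem_support_of_mem_edges hj hx)
  -- By disjointness, no edge of `P` leaves the support of a path.
  have hconn : ∀ v, v ∈ C ↔ ∃ i, EdgeConn ends P (s i) v := by
    intro v
    rw [hC]
    refine exists_congr fun i =>
      ⟨(p i).edgeConn fun f hf => (hPe f).2 ⟨i, hf⟩, fun h => ?_⟩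
    induction h with
    | refl => exact (p i).start_mem
    | @tail a b _ h ih =>
      obtain ⟨f, hf, hab⟩ := h
      obtain ⟨j, hj⟩ := (hPe f).1 hf
      have ha := (p j).mem_support_of_mem_edges hj (x := a) (by simp [hab])
      have hb := (p j).mem_support_of_mem_edges hj (x := b) (by simp [hab])
      by_cases hij : i = j
      · exact hij ▸ hb
      · exact absurd ha (hd i j hij a ih)
  have hcompl : Cᶜ = (Finset.univ.filter fun v : NonTerminal s t =>
      ∀ i, ¬ EdgeConn ends P (s i) v).map (Function.Embedding.subtype _) := by
    ext v
    simp only [Finset.mem_compl, hconn, not_exists, Finset.mem_map, Finset.mem_filter,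
      Finset.mem_univ, true_and, Function.Embedding.subtype_apply]
    constructor
    · intro h
      refine ⟨⟨v, ?_, ?_⟩, h, rfl⟩
      · rintro i rfl
        exact h i (EdgeConn.refl _)
      · rintro j rfl
        refine (not_exists.2 h) ((hconn _).1 ((hC _).2 ⟨σ.symm j, ?_⟩))
        simpa using (p (σ.symm j)).end_mem
    · rintro ⟨u, h, rfl⟩
      exact h
  have h1 := Finset.card_add_card_compl C
  rw [hcompl, Finset.card_map, card_vertices hs ht hst, hCcard, Finset.sum_add_distrib,
    ← hPcard] at h1
  simp only [Finset.sum_const, Finset.card_univ, Fintype.card_fin, smul_eq_mul, mul_one] at h1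
  rw [extendToBase, Finset.card_disjSum]
  omega

/-- A disjoint path extended by the new edges at the vertices it avoids is a common base. -/
theorem isCommonBase_extendToBase (hs : Function.Injective s) (ht : Function.Injective t)
    (hst : ∀ i j, s i ≠ t j) (D : EdgeOrientation (starEnds ends s t)) {P : Finset E}
    (hP : IsDisjointPath ends s t P) :
    IsCommonBase (tutteMatrix D s) (tutteMatrix D t) (extendToBase ends s t P) := by
  classical
  have e : (Fin k ⊕ NonTerminal s t) ≃ extendToBase ends s t P :=
    Fintype.equivOfCardEq (by simp [card_extendToBase hs ht hst hP])
  obtain ⟨σ, hσ⟩ := hP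
  have hsub : liftEdges s t P ⊆ extendToBase ends s t P := by
    rw [liftEdges_subset_iff, toLeft_extendToBase]
  -- A vertex not linked to a source by `P` is non-terminal, as every target lies on a path, so its
  -- new edge was added.
  have hterm : ∀ v : V, (∃ i, EdgeConn ends P (s i) v) ∨
      EdgeConn (starEnds ends s t) (extendToBase ends s t P) (some v) none := by
    intro v
    by_contra! h
    obtain ⟨h, hn⟩ := h
    have hvs : ∀ i, v ≠ s i := by
      rintro i rfl
      exact h i (EdgeConn.refl _)
    have hvt : ∀ j, v ≠ t j := by
      rintro j rfl
      refine h (σ.symm j) ?_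
      simpa using hσ.edgeConn (σ.symm j)
    refine hn (EdgeConn.of_edge (f := Sum.inr ⟨v, hvs, hvt⟩) ?_ rfl)
    simp [extendToBase, h]
  constructor
  · refine ⟨e, det_incidenceRows_ne_zero ℚ D (source_injective hs) e ?_⟩
    rintro (_ | v)
    · exact ⟨none, none_notMem_range_rowVertex s, EdgeConn.refl _⟩
    · rcases hterm v with ⟨i, hi⟩ | h
      · exact ⟨_, target_notMem_range hst (σ i), (hi.symm.trans (hσ.edgeConn i)).star hsub⟩
      · exact ⟨none, none_notMem_range_rowVertex s, h⟩
  · refine ⟨e, det_incidenceRows_ne_zero ℚ D (target_injective ht) e ?_⟩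
    rintro (_ | v)
    · exact ⟨none, none_notMem_range_rowVertex t, EdgeConn.refl _⟩
    · rcases hterm v with ⟨i, hi⟩ | h
      · exact ⟨_, source_notMem_range hst i, hi.symm.star hsub⟩
      · exact ⟨none, none_notMem_range_rowVertex t, h⟩

/-- A common base whose old edges form a disjoint path is determined by this path. -/
theorem eq_extendToBase (hs : Function.Injective s) (ht : Function.Injective t)
    (hst : ∀ i j, s i ≠ t j) (D : EdgeOrientation (starEnds ends s t))
    {B : Finset (E ⊕ NonTerminal s t)}
    (hB : IsCommonBase (tutteMatrix D s) (tutteMatrix D t) B)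
    (hP : IsDisjointPath ends s t B.toLeft) : extendToBase ends s t B.toLeft = B := by
  classical
  obtain ⟨e, h2⟩ := hB.2
  rw [subDet_tutteMatrix] at h2
  -- A new edge of `B` at a vertex on the path would join a source to `v*`, which the target matrix
  -- forbids. Hence `B` lies in the extension, and the cardinalities agree.
  refine (Finset.eq_of_subset_of_card_le ?_ ?_).symm
  · rintro (f | v) hf
    · simpa [extendToBase] using hf
    · simp only [extendToBase, Finset.inr_mem_disjSum, Finset.mem_filter, Finset.mem_univ,
        true_and]
      intro i hi
      have hc : EdgeConn (starEnds ends s t) B (some (s i)) none :=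
        (hi.star (liftEdges_subset_iff.2 subset_rfl)).trans (EdgeConn.of_edge hf rfl)
      exact Option.some_ne_none _ (eq_of_edgeConn_of_det_ne_zero D (target_injective ht) e h2
        (source_notMem_range hst i) (none_notMem_range_rowVertex t) hc)
  · rw [card_extendToBase hs ht hst hP]
    simpa using (Fintype.card_congr e).le

theorem sum_extendToBase (l : E → ℝ) (P : Finset E) :
    ∑ f ∈ extendToBase ends s t P, starWeight s t l f = ∑ e ∈ P, l e := by
  rw [sum_starWeight, toLeft_extendToBase]

theorem isMinWeightCommonBase_extendToBase (hs : Function.Injective s)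
    (ht : Function.Injective t) (hst : ∀ i j, s i ≠ t j)
    (D : EdgeOrientation (starEnds ends s t)) {l : E → ℝ} (hl : ∀ e, 0 < l e) {P : Finset E}
    (hP : IsShortestDisjointPath ends s t l P) :
    IsMinWeightCommonBase (tutteMatrix D s) (tutteMatrix D t) (starWeight s t l)
      (extendToBase ends s t P) := by
  refine ⟨isCommonBase_extendToBase hs ht hst D hP.1, fun B hB => ?_⟩
  obtain ⟨Q, hQ, hQB⟩ := exists_isDisjointPath_of_isCommonBase hs ht hst D hB
  rw [sum_extendToBase]
  exact (hP.2 Q hQ).trans (sum_liftEdges_le hl hQB)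

/-- The old edges of `B` contain a disjoint path `P`, but by minimality weigh no more than the
extension of `P`; positive lengths leave no room for further old edges. -/
theorem isShortestDisjointPath_toLeft (hs : Function.Injective s)
    (ht : Function.Injective t) (hst : ∀ i j, s i ≠ t j)
    (D : EdgeOrientation (starEnds ends s t)) {l : E → ℝ} (hl : ∀ e, 0 < l e)
    {B : Finset (E ⊕ NonTerminal s t)}
    (hB : IsMinWeightCommonBase (tutteMatrix D s) (tutteMatrix D t) (starWeight s t l) B) :
    IsShortestDisjointPath ends s t l B.toLeft := by
  have hle : ∀ Q, IsDisjointPath ends s t Q → ∑ e ∈ B.toLeft, l e ≤ ∑ e ∈ Q, l e := by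
    intro Q hQ
    have := hB.2 _ (isCommonBase_extendToBase hs ht hst D hQ)
    rwa [sum_extendToBase, sum_starWeight] at this
  obtain ⟨P, hP, hPB⟩ := exists_isDisjointPath_of_isCommonBase hs ht hst D hB.1
  have := eq_of_subset_of_sum_le hl (liftEdges_subset_iff.1 hPB) (hle P hP)
  exact ⟨this ▸ hP, hle⟩

/-- The sign of a disjoint path in terms of a common base containing it. -/
theorem pathSign_eq (hs : Function.Injective s) (ht : Function.Injective t)
    (hst : ∀ i j, s i ≠ t j) (D : EdgeOrientation (starEnds ends s t))
    {P : Finset E} {B : Finset (E ⊕ NonTerminal s t)} (hP : IsDisjointPath ends s t P)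
    (hB : IsCommonBase (tutteMatrix D s) (tutteMatrix D t) B) (hPB : liftEdges s t P ⊆ B)
    (e : (Fin k ⊕ NonTerminal s t) ≃ B) :
    pathSign ends s t P =
      (-1) ^ k * (subDet (tutteMatrix D s) B e * subDet (tutteMatrix D t) B e) := by
  obtain ⟨σ, hσ⟩ := hP
  rw [subDet_mul_subDet_of_edgeConn hs ht hst D e (exists_det_ne_zero_of_isCommonBase D hB e).1
    fun i => (hσ.edgeConn i).star hPB, ← mul_assoc, ← mul_pow, pathSign, pathPerm_eq hσ]
  simp

theorem isPfaffianWith_of_lgvPosition (hs : Function.Injective s) (ht : Function.Injective t)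
    (hst : ∀ i j, s i ≠ t j) (D : EdgeOrientation (starEnds ends s t))
    (h : LGVPosition ends s t) {P : Finset E} (hP : IsDisjointPath ends s t P) :
    IsPfaffianWith (tutteMatrix D s) (tutteMatrix D t) ((-1) ^ k * pathSign ends s t P) := by
  refine ⟨mul_ne_zero (by simp) (by simp [pathSign]), fun B hB e => ?_⟩
  obtain ⟨Q, hQ, hQB⟩ := exists_isDisjointPath_of_isCommonBase hs ht hst D hB
  rw [h P Q hP hQ, pathSign_eq hs ht hst D hQ hB hQB e, ← mul_assoc, ← mul_pow]
  simp

theorem isPfaffian_of_lgvPosition (hs : Function.Injective s) (ht : Function.Injective t)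
    (hst : ∀ i j, s i ≠ t j) (D : EdgeOrientation (starEnds ends s t))
    (h : LGVPosition ends s t) : IsPfaffian (tutteMatrix D s) (tutteMatrix D t) := by
  by_cases hex : ∃ P, IsDisjointPath ends s t P
  · obtain ⟨P, hP⟩ := hex
    exact ⟨_, isPfaffianWith_of_lgvPosition hs ht hst D h hP⟩
  -- Without disjoint paths there are no common bases, and any nonzero constant works.
  · refine ⟨1, one_ne_zero, fun B hB => absurd ?_ hex⟩
    obtain ⟨P, hP, -⟩ := exists_isDisjointPath_of_isCommonBase hs ht hst D hB
    exact ⟨P, hP⟩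

end CommonBases

end STPaths

/-! ### The three assertions -/

theorem mainTheorem9 {V E : Type*} [Fintype V] [DecidableEq V] [Finite E]
    (ends : E → Sym2 V) {k : ℕ}
    (s t : Fin k → V) (hs : Function.Injective s) (ht : Function.Injective t)
    (hst : ∀ i j, s i ≠ t j)
    (D : STPaths.EdgeOrientation (STPaths.starEnds ends s t)) :
    -- the sign formula
    (∀ (P : Finset E) (B : Finset (E ⊕ STPaths.NonTerminal s t)),
      STPaths.IsDisjointPath ends s t P →
      STPaths.IsCommonBase (STPaths.tutteMatrix D s) (STPaths.tutteMatrix D t) B →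
      STPaths.liftEdges s t P ⊆ B →
      ∀ e : (Fin k ⊕ STPaths.NonTerminal s t) ≃ B,
        STPaths.pathSign ends s t P =
          (-1) ^ k * STPaths.subDet (STPaths.tutteMatrix D s) B e *
            STPaths.subDet (STPaths.tutteMatrix D t) B e) ∧
    -- in the LGV position the pair is Pfaffian
    (STPaths.LGVPosition ends s t →
      STPaths.IsPfaffian (STPaths.tutteMatrix D s) (STPaths.tutteMatrix D t) ∧
      ∀ P : Finset E, STPaths.IsDisjointPath ends s t P →
        STPaths.IsPfaffianWith (STPaths.tutteMatrix D s) (STPaths.tutteMatrix D t)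
          ((-1) ^ k * STPaths.pathSign ends s t P)) ∧
    -- shortest disjoint paths and minimum-weight common bases
    (∀ l : E → ℝ, (∀ e, 0 < l e) →
      (∀ x : ℝ,
        IsLeast {y | ∃ P : Finset E, STPaths.IsDisjointPath ends s t P ∧
          ∑ e ∈ P, l e = y} x ↔
        IsLeast {y | ∃ B : Finset (E ⊕ STPaths.NonTerminal s t),
          STPaths.IsCommonBase (STPaths.tutteMatrix D s) (STPaths.tutteMatrix D t) B ∧
          ∑ e ∈ B, STPaths.starWeight s t l e = y} x) ∧
      ∃ Φ : {P : Finset E // STPaths.IsShortestDisjointPath ends s t l P} ≃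
          {B : Finset (E ⊕ STPaths.NonTerminal s t) //
            STPaths.IsMinWeightCommonBase (STPaths.tutteMatrix D s) (STPaths.tutteMatrix D t)
              (STPaths.starWeight s t l) B},
        ∀ P B, Φ P = B ↔ STPaths.liftEdges s t P.1 ⊆ B.1) := by
  refine ⟨fun P B hP hB hPB e => ?_, fun h => ⟨?_, fun P hP => ?_⟩, fun l hl => ⟨fun x => ?_, ?_⟩⟩
  · rw [STPaths.pathSign_eq hs ht hst D hP hB hPB e, mul_assoc]
  · exact STPaths.isPfaffian_of_lgvPosition hs ht hst D h
  · exact STPaths.isPfaffianWith_of_lgvPosition hs ht hst D h hP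
  · constructor
    · rintro ⟨⟨P, hP, rfl⟩, hx⟩
      refine ⟨⟨_, STPaths.isCommonBase_extendToBase hs ht hst D hP,
        STPaths.sum_extendToBase l P⟩, ?_⟩
      rintro _ ⟨B, hB, rfl⟩
      obtain ⟨Q, hQ, hQB⟩ := STPaths.exists_isDisjointPath_of_isCommonBase hs ht hst D hB
      exact (hx ⟨Q, hQ, rfl⟩).trans (STPaths.sum_liftEdges_le hl hQB)
    · rintro ⟨⟨B, hB, rfl⟩, hx⟩
      have hmin : STPaths.IsMinWeightCommonBase (STPaths.tutteMatrix D s)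
          (STPaths.tutteMatrix D t) (STPaths.starWeight s t l) B :=
        ⟨hB, fun B' hB' => hx ⟨B', hB', rfl⟩⟩
      have hP := STPaths.isShortestDisjointPath_toLeft hs ht hst D hl hmin
      rw [STPaths.sum_starWeight]
      refine ⟨⟨_, hP.1, rfl⟩, ?_⟩
      rintro _ ⟨Q, hQ, rfl⟩
      exact hP.2 Q hQ
  -- `Φ` adds the new edges at avoided vertices; its inverse forgets all new edges.
  · refine ⟨{
      toFun := fun P => ⟨_, STPaths.isMinWeightCommonBase_extendToBase hs ht hst D hl P.2⟩
      invFun := fun B => ⟨_, STPaths.isShortestDisjointPath_toLeft hs ht hst D hl B.2⟩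
      left_inv := fun P => Subtype.ext (STPaths.toLeft_extendToBase P.1)
      right_inv := fun B => Subtype.ext (STPaths.eq_extendToBase hs ht hst D B.2.1
        (STPaths.isShortestDisjointPath_toLeft hs ht hst D hl B.2).1) }, fun P B => ?_⟩
    rw [STPaths.liftEdges_subset_iff]
    constructor
    · rintro rfl
      exact (STPaths.toLeft_extendToBase P.1).ge
    · intro hPB
      have hBs := STPaths.isShortestDisjointPath_toLeft hs ht hst D hl B.2
      -- Both `P` and the old edges of `B` are shortest, so the inclusion is an equality.
      have heq := STPaths.eq_of_subset_of_sum_le hl hPB (hBs.2 P.1 P.2.1)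
      refine Subtype.ext ?_
      change STPaths.extendToBase ends s t P.1 = B.1
      rw [heq]
      exact STPaths.eq_extendToBase hs ht hst D B.2.1 hBs.1
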